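/- Let $A$ be an abelian topological group, $\mathbb T\subseteq\mathbb C$ the circle group, and $\mathcal F$ the group of all continuous homomorphisms $A\to\mathbb T$. Let $M=(A,+,-,0,f)_{f\in\mathcal F}$, a structure of continuous logic: each $f\in\mathcal F$ is a $\mathbb T$-valued predicate, equality is a $\{0,1\}$-valued formula with value $0$ meaning equal, the connectives are all continuous functions $\mathbb C^n\to\mathbb C$, and the quantifiers are $\sup_x|\cdot|$ and $\inf_x|\cdot|$. Then $M$ has a saturated elementary extension; here an elementary extension $M^*=(A^*,+^*,-^*,0^*,f^*)_{f\in\mathcal F}$ of $M$ is called saturated if every set of conditions $\varphi(x_1,\dots,x_n)=0$ with parameters from $A$, all of whose finite subsets are satisfiable in $M^*$, is satisfiable in $M^*$. Let $M^*$ be any such extension. For $a\in A^*$ let $\mathrm{tp}_{\mathcal F}(a)=(f^*(a))_{f\in\mathcal F}\in\mathbb T^{\mathcal F}$, let $S_{\mathcal F}(M)=\{\mathrm{tp}_{\mathcal F}(a):a\in A^*\}$, and for $p=\mathrm{tp}_{\mathcal F}(a)$ write $f^*(p)=f^*(a)$. Give $S_{\mathcal F}(M)$ the coarsest topology making all the maps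 $p\mapsto f^*(p)$, $f\in\mathcal F$, continuous. (i) The operation $p+^*q=\mathrm{tp}_{\mathcal F}(a+^*b)$, where $p=\mathrm{tp}_{\mathcal F}(a)$ and $q=\mathrm{tp}_{\mathcal F}(b)$, is well defined and makes $S_{\mathcal F}(M)$ into a compact (Hausdorff) abelian topological group. (ii) The map sending $p\in S_{\mathcal F}(M)$ to the map $f\mapsto f^*(p)$ is an isomorphism of topological groups from $S_{\mathcal F}(M)$ onto the Pontryagin dual of $\mathcal F$, where $\mathcal F$ is considered as a discrete group and its dual, the group of all homomorphisms $\mathcal F\to\mathbb T$, has the compact-open topology. (iii) The map $j:A\to S_{\mathcal F}(M)$, $j(a)=\mathrm{tp}_{\mathcal F}(a)$, is a continuous homomorphism, and it is (isomorphic to) the Bohr compactification $A\to bA$; that is, for every compact Hausdorff topological group $D$ (commutative or not) and every continuous homomorphism $g:A\to D$ there is a unique continuous homomorphism $h:S_{\mathcal F}(M)\to D$ with $g=h\circ j$. -/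

import Mathlib

universe u v w

namespace ContLogic

/-- Terms of the language `(+, -, 0)` with variables from `V`. -/
inductive Term (V : Type v) : Type v
  | var (x : V) : Term V
  | zero : Term V
  | add (s t : Term V) : Term V
  | neg (t : Term V) : Term V

/-- Formulas of continuous logic in the language `(+, -, 0, f)_{f ∈ F}`, where every `f ∈ F` is a
unary `𝕋`-valued predicate symbol.  The variables are those of the type `α` together with
`x₀, …, xₙ₋₁`; the quantifiers bind the last variable `xₙ`.  The connectives are all the
continuous functions `ℂᵏ → ℂ`, the quantifiers are `sup_x |·|` and `inf_x |·|`.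
Thus `Formula F Empty n` is the set of formulas `φ(x₀, …, xₙ₋₁)` without parameters, and
`Formula F A n` is the set of formulas `φ(x₀, …, xₙ₋₁)` with parameters named by elements
of `A`. -/
inductive Formula (F : Type u) (α : Type v) : ℕ → Type (max u v)
  | eq {n : ℕ} (s t : Term (α ⊕ Fin n)) : Formula F α n
  | pred {n : ℕ} (f : F) (t : Term (α ⊕ Fin n)) : Formula F α n
  | conn {n k : ℕ} (c : C(Fin k → ℂ, ℂ)) (φ : Fin k → Formula F α n) : Formula F α n
  | sup {n : ℕ} (φ : Formula F α (n + 1)) : Formula F α n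
  | inf {n : ℕ} (φ : Formula F α (n + 1)) : Formula F α n

/-- A continuous logic structure `(N, +, -, 0, f)_{f ∈ F}`.  The metric is the discrete one, and the
prescribed range of each predicate symbol is the unit circle `𝕋 ⊆ ℂ`.  No axioms are
imposed on the operations or on the predicates. -/
structure Str (F : Type u) (N : Type w) where
  zero : N
  add : N → N → N
  neg : N → N
  pred : F → N → Circle

/-- The value of a term. -/
def Term.eval {F : Type u} {N : Type w} {V : Type v} (M : Str F N) (val : V → N) : Term V → N
  | .var x => val x
  | .zero => M.zero
  | .add s t => M.add (s.eval M val) (t.eval M val)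
  | .neg t => M.neg (t.eval M val)

open Classical in
/-- The complex value of a formula in a structure; equality has value `0` for equal and `1`
for different elements. -/
noncomputable def Formula.eval {F : Type u} {N : Type w} {α : Type v} (M : Str F N) (val : α → N) :
    {n : ℕ} → Formula F α n → (Fin n → N) → ℂ
  | _, .eq s t, xs =>
      if s.eval M (Sum.elim val xs) = t.eval M (Sum.elim val xs) then 0 else 1
  | _, .pred f t, xs => (M.pred f (t.eval M (Sum.elim val xs)) : ℂ)
  | _, .conn c φ, xs => c fun k => (φ k).eval M val xs
  | n, .sup φ, xs => ((⨆ x : N, ‖φ.eval M val (Fin.snoc xs x : Fin (n + 1) → N)‖ : ℝ) : ℂ)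
  | n, .inf φ, xs => ((⨅ x : N, ‖φ.eval M val (Fin.snoc xs x : Fin (n + 1) → N)‖ : ℝ) : ℂ)

/-- Every formula is bounded, so that the suprema above are genuine ones. -/
theorem Formula.eval_bounded {F : Type u} {α : Type v} {n : ℕ} (φ : Formula F α n) :
    ∃ C : ℝ, ∀ (N : Type w) (M : Str F N) (val : α → N) (xs : Fin n → N),
      ‖φ.eval M val xs‖ ≤ C := by
  induction φ with
  | eq s t =>
    refine ⟨1, fun N M val xs => ?_⟩
    simp only [Formula.eval]
    split_ifs <;> simp
  | pred f t =>
    refine ⟨1, fun N M val xs => ?_⟩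
    simp only [Formula.eval]
    exact (Circle.norm_coe _).le
  | @conn n k c φ ih =>
    choose C hC using ih
    have hK : IsCompact (Set.univ.pi fun j : Fin k => Metric.closedBall (0 : ℂ) (C j)) :=
      isCompact_univ_pi fun j => isCompact_closedBall _ _
    obtain ⟨B, hB⟩ := hK.exists_bound_of_continuousOn c.continuous.continuousOn
    refine ⟨B, fun N M val xs => ?_⟩
    simp only [Formula.eval]
    refine hB _ fun j _ => ?_
    simpa using hC j N M val xs
  | @sup n φ ih =>
    obtain ⟨C, hC⟩ := ih
    refine ⟨C, fun N M val xs => ?_⟩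
    have : Nonempty N := ⟨M.zero⟩
    simp only [Formula.eval, Complex.norm_real, Real.norm_eq_abs]
    rw [abs_of_nonneg (Real.iSup_nonneg fun x => norm_nonneg _)]
    exact ciSup_le fun x => hC N M val _
  | @inf n φ ih =>
    obtain ⟨C, hC⟩ := ih
    refine ⟨C, fun N M val xs => ?_⟩
    simp only [Formula.eval, Complex.norm_real, Real.norm_eq_abs]
    rw [abs_of_nonneg (Real.iInf_nonneg fun x => norm_nonneg _)]
    exact (ciInf_le ⟨0, by rintro _ ⟨x, rfl⟩; exact norm_nonneg _⟩ M.zero).trans (hC N M val _)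

/-- `i : M → N` is an elementary embedding, that is, it makes `N` an elementary extension of `M`. -/
def IsElementary {F : Type u} {A : Type v} {N : Type w} (M : Str F A) (M' : Str F N)
    (i : A → N) : Prop :=
  ∀ (n : ℕ) (φ : Formula F Empty n) (a : Fin n → A),
    φ.eval M' Empty.elim (fun k => i (a k)) = φ.eval M Empty.elim a

/-- `N` is saturated over (the image under `i` of) `A`: every set `Γ` of conditions
`φ(x₀, …, xₙ₋₁) = 0` with parameters from `A`, all of whose finite subsets are satisfiable in `N`,
is satisfiable in `N`. Every `κ`-saturated structure with `κ > |A|` has this property. -/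
def IsSaturatedOver {F : Type u} {A : Type v} {N : Type w} (M' : Str F N) (i : A → N) : Prop :=
  ∀ (n : ℕ) (Γ : Set (Formula F A n)),
    (∀ Δ : Finset (Formula F A n), (Δ : Set (Formula F A n)) ⊆ Γ →
      ∃ x : Fin n → N, ∀ φ ∈ Δ, φ.eval M' i x = 0) →
    ∃ x : Fin n → N, ∀ φ ∈ Γ, φ.eval M' i x = 0

/-- The space of `F`-types: the families of values `(f(a))_{f ∈ F}` of elements `a` of the structure.
For a saturated elementary extension `M'` of `M` this is the local type space of `M`. -/
def TypeSpace {F : Type u} {N : Type w} (M' : Str F N) : Type u :=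
  {p : F → Circle // ∃ a : N, (fun f => M'.pred f a) = p}

/-- The `F`-type of an element. -/
def tp {F : Type u} {N : Type w} (M' : Str F N) (a : N) : TypeSpace M' :=
  ⟨fun f => M'.pred f a, a, rfl⟩

/-- The value `f*(p) ∈ 𝕋`, that is, the value of `f` at any realization of `p`. -/
def TypeSpace.value {F : Type u} {N : Type w} {M' : Str F N} (f : F) (p : TypeSpace M') : Circle :=
  p.1 f

/-- The type space topology: the coarsest one for which all the maps `p ↦ f*(p)` are continuous. -/
noncomputable instance {F : Type u} {N : Type w} (M' : Str F N) : TopologicalSpace (TypeSpace M') :=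
  ⨅ f : F, TopologicalSpace.induced (TypeSpace.value f) inferInstance

end ContLogic

/-- The abstract group of continuous homomorphisms from the additive group `A` to the circle. -/
def CharGroup (A : Type u) [AddCommGroup A] [TopologicalSpace A] : Type u :=
  Multiplicative A →ₜ* Circle

noncomputable instance (A : Type u) [AddCommGroup A] [TopologicalSpace A] :
    CommGroup (CharGroup A) :=
  inferInstanceAs (CommGroup (Multiplicative A →ₜ* Circle))

/-- The group of characters is considered as a discrete group. -/
instance (A : Type u) [AddCommGroup A] [TopologicalSpace A] : TopologicalSpace (CharGroup A) := ⊥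

instance (A : Type u) [AddCommGroup A] [TopologicalSpace A] : DiscreteTopology (CharGroup A) := ⟨rfl⟩

/-- The value of a character. -/
noncomputable def CharGroup.app {A : Type u} [AddCommGroup A] [TopologicalSpace A] (f : CharGroup A) (a : A) :
    Circle :=
  ContinuousMonoidHom.toMonoidHom f (Multiplicative.ofAdd a)

/-- The continuous logic structure `(A, +, -, 0, f)_{f ∈ F}`, with `F` the group of all
continuous homomorphisms from `A` to the circle. -/
noncomputable def charStr (A : Type u) [AddCommGroup A] [TopologicalSpace A] : ContLogic.Str (CharGroup A) A where
  zero := 0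
  add a b := a + b
  neg a := -a
  pred f a := f.app a

/-- `ι : A → C` is the Bohr compactification of `A`: the group `C` is compact (Hausdorff), and `ι`
is universal among the continuous homomorphisms from `A` to compact (Hausdorff) groups,
commutative or not. -/
def IsBohrCompactification {A : Type u} [AddGroup A] [TopologicalSpace A]
    {C : Type v} [AddGroup C] [TopologicalSpace C] (ι : A →ₜ+ C) : Prop :=
  IsTopologicalAddGroup C ∧ CompactSpace C ∧ T2Space C ∧
    ∀ (D : Type w) [AddGroup D] [TopologicalSpace D] [IsTopologicalAddGroup D] [CompactSpace D]
      [T2Space D] (g : A →ₜ+ D), ∃! h : C →ₜ+ D, ∀ a : A, h (ι a) = g a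

/-! The crux is that evaluation sends `A` onto a dense subgroup of the dual of the discrete group of
characters (`CharGroup.denseRange_evalPoint`). Granting this, every homomorphism from the character
group to the circle is approximated, on finitely many characters at a time, by points of `A`, so
saturation realizes it in `M'` (`charStr_exists_pred_eq`). Conversely, the identities `f(x + y) =
f(x) f(y)` and `(fg)(x) = f(x) g(x)` pass to `M'` by elementarity: every type is a homomorphism, and
the type of a sum depends only on the types of the summands. Hence the type space is the compact
dual.

Density holds because a nontrivial character is nontrivial at some point of `A`. If the closure `H`
of a subgroup on which no nontrivial evaluation is trivial were proper, the Haar averages over `H`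
and over a different coset would agree on all evaluations, hence by Stone–Weierstrass on all
continuous functions, contradicting Urysohn's lemma.

For the Bohr property, the closure of the image of `A` in a compact group is compact abelian, so its
characters embed it in a power of the circle. These characters pull back to `A`, then extend to the
type space as evaluations; density does the rest. That characters separate points
(`exists_character_ne_one`) comes from the regular representation and Gelfand theory. Saturated
extensions are ultrapowers, by Łoś's theorem. -/

section

open MeasureTheory

/-! ### Operators obtained by integrating a unitary representation. -/

namespace UnitaryRep

variable {K : Type*} [Group K] [TopologicalSpace K] [CompactSpace K]
  [MeasurableSpace K] [BorelSpace K] (μ : Measure K) [IsFiniteMeasure μ]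
  {H : Type*} [NormedAddCommGroup H] [InnerProductSpace ℂ H] [CompleteSpace H]
  (U : K →* unitary (H →L[ℂ] H))

theorem integrable_smul (hU : ∀ v, Continuous fun x => (U x : H →L[ℂ] H) v) (f : C(K, ℂ)) (v : H) :
    Integrable (fun x => f x • (U x : H →L[ℂ] H) v) μ :=
  (f.continuous.smul (hU v)).integrable_of_hasCompactSupport
    (HasCompactSupport.of_compactSpace _)

/-- The operator `∫ f(x) U(x) dμ(x)`, as a continuous linear function of `f`. -/
noncomputable def integratedForm (hU : ∀ v, Continuous fun x => (U x : H →L[ℂ] H) v) :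
    C(K, ℂ) →L[ℂ] H →L[ℂ] H :=
  LinearMap.mkContinuous₂
    (LinearMap.mk₂ ℂ (fun f v => ∫ x, f x • (U x : H →L[ℂ] H) v ∂μ)
      (fun f g v => by
        rw [← integral_add (integrable_smul μ U hU f v) (integrable_smul μ U hU g v)]
        simp [add_smul])
      (fun c f v => by
        rw [← integral_smul]
        simp [mul_smul])
      (fun f v w => by
        rw [← integral_add (integrable_smul μ U hU f v) (integrable_smul μ U hU f w)]
        simp)
      (fun c f v => by
        rw [← integral_smul]
        simp [smul_comm _ c]))
    (μ.real Set.univ)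
    (fun f v => by
      have : ∀ x, ‖f x • (U x : H →L[ℂ] H) v‖ ≤ ‖f‖ * ‖v‖ := fun x => by
        rw [norm_smul]
        have := (Unitary.norm_map (U x) v)
        gcongr
        · exact f.norm_coe_le_norm x
        · exact this.le
      simpa [mul_comm, mul_assoc, mul_left_comm] using
        norm_integral_le_of_norm_le_const (μ := μ) (Filter.Eventually.of_forall this))

variable (hU : ∀ v, Continuous fun x => (U x : H →L[ℂ] H) v)

theorem integratedForm_apply (f : C(K, ℂ)) (v : H) :
    integratedForm μ U hU f v = ∫ x, f x • (U x : H →L[ℂ] H) v ∂μ := rfl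

/-- Invariance of the measure moves `U y` onto the function `f`. Since translates of `f` vary
continuously in the sup norm, `y ↦ U y * T` becomes norm continuous for `T` an integrated operator,
although `U` is only strongly continuous. -/
theorem mul_integratedForm [IsTopologicalGroup K] [μ.IsMulLeftInvariant] (f : C(K, ℂ)) (y : K) :
    (U y : H →L[ℂ] H) * integratedForm μ U hU f =
      integratedForm μ U hU (f.comp (ContinuousMap.mulLeft y⁻¹)) := by
  ext v
  change (U y : H →L[ℂ] H) (integratedForm μ U hU f v) = _
  rw [integratedForm_apply, integratedForm_apply,
    ← ContinuousLinearMap.integral_comp_comm _ (integrable_smul μ U hU f v),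
    ← integral_mul_left_eq_self (fun x => (f.comp (ContinuousMap.mulLeft y⁻¹)) x • _) y]
  simp

theorem commute_integratedForm (f : C(K, ℂ)) (S : H →L[ℂ] H) (hS : ∀ x, Commute S (U x)) :
    Commute S (integratedForm μ U hU f) := by
  ext v
  change S (integratedForm μ U hU f v) = integratedForm μ U hU f (S v)
  rw [integratedForm_apply, integratedForm_apply,
    ← ContinuousLinearMap.integral_comp_comm _ (integrable_smul μ U hU f v)]
  refine integral_congr_ae (.of_forall fun x => ?_)
  have := congrArg (fun T : H →L[ℂ] H => T v) (hS x).eq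
  simpa using congrArg (f x • ·) this

end UnitaryRep

end

/-! ### Characters of a compact abelian group from a unitary representation. -/

section

open MeasureTheory
open scoped InnerProductSpace ComplexConjugate

/-- The closure of the generated star algebra is a commutative C*-algebra, and its Gelfand transform
is isometric, so some character of it does not vanish at `T`. -/
theorem CStarAlgebra.exists_algHom_apply_ne_zero {A : Type*} [CStarAlgebra A] {s : Set A}
    (hcomm : ∀ x ∈ s, ∀ y ∈ s, x * y = y * x)
    (hstar : ∀ x ∈ s, ∀ y ∈ s, x * star y = star y * x) {T : A}
    (hT : T ∈ StarAlgebra.adjoin ℂ s) (hT0 : T ≠ 0) :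
    ∃ ω : StarAlgebra.adjoin ℂ s →ₐ[ℂ] ℂ, Continuous ω ∧ ω ⟨T, hT⟩ ≠ 0 := by
  have := StarAlgebra.isMulCommutative_adjoin ℂ hcomm hstar
  let B := (StarAlgebra.adjoin ℂ s).topologicalClosure
  have hB : IsClosed (B : Set A) := (StarAlgebra.adjoin ℂ s).isClosed_topologicalClosure
  let _ : CommCStarAlgebra B :=
    { StarSubalgebra.cstarAlgebra B with
      mul_comm := (StarSubalgebra.commRingTopologicalClosure (StarAlgebra.adjoin ℂ s)
        (fun x y => mul_comm' x y)).mul_comm }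
  let i := StarSubalgebra.inclusion (StarSubalgebra.le_topologicalClosure (StarAlgebra.adjoin ℂ s))
  have hi : Continuous i := (StarSubalgebra.isEmbedding_inclusion _).continuous
  have h0 : WeakDual.gelfandTransform ℂ B (i ⟨T, hT⟩) ≠ 0 := fun h => by
    have h1 := (gelfandTransform_isometry B).injective (h.trans (map_zero _).symm)
    exact hT0 (congrArg Subtype.val h1)
  obtain ⟨ω, hω⟩ : ∃ ω, WeakDual.gelfandTransform ℂ B (i ⟨T, hT⟩) ω ≠ 0 := by
    by_contra! h
    exact h0 (ContinuousMap.ext h)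
  exact ⟨(WeakDual.CharacterSpace.toAlgHom ω).comp i.toAlgHom, (map_continuous ω).comp hi, hω⟩

namespace UnitaryRep

variable {K : Type*} [CommGroup K] [TopologicalSpace K] [CompactSpace K]
  {H : Type*} [NormedAddCommGroup H] [InnerProductSpace ℂ H] [CompleteSpace H]
  (U : K →* unitary (H →L[ℂ] H))

theorem exists_integratedForm_apply_ne_zero
    [MeasurableSpace K] [BorelSpace K] (μ : Measure K) [μ.IsHaarMeasure]
    (hU : ∀ v, Continuous fun x => (U x : H →L[ℂ] H) v) {w : H} (hw : w ≠ 0) :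
    ∃ f, integratedForm μ U hU f w ≠ 0 := by
  -- With this conjugated matrix coefficient, `⟪w, T w⟫` is the integral of `‖f x‖ ^ 2`, which is
  -- positive because `f` is continuous and nonzero at `1`.
  let f : C(K, ℂ) := ⟨fun x => conj ⟪w, (U x : H →L[ℂ] H) w⟫_ℂ, by have := hU w; fun_prop⟩
  refine ⟨f, fun h => ?_⟩
  have h1 : ⟪w, integratedForm μ U hU f w⟫_ℂ = 0 := by rw [h, inner_zero_right]
  rw [integratedForm_apply, ← integral_inner (integrable_smul μ U hU f w)] at h1
  have h2 : ∀ x, ⟪w, f x • (U x : H →L[ℂ] H) w⟫_ℂ = ((‖f x‖ ^ 2 : ℝ) : ℂ) := fun x => by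
    rw [inner_smul_right, mul_comm, ← Complex.normSq_eq_norm_sq, Complex.normSq_eq_conj_mul_self]
    simp [f]
  simp_rw [h2] at h1
  rw [integral_complex_ofReal, Complex.ofReal_eq_zero] at h1
  have hc : Continuous fun x => ‖f x‖ ^ 2 := by fun_prop
  refine (hc.integral_pos_of_hasCompactSupport_nonneg_nonzero (μ := μ)
    (HasCompactSupport.of_compactSpace _) (fun x => by positivity) (x := 1) ?_).ne' h1
  simpa [f] using hw

/-- The operators `U x`, an integrated operator `T` and its adjoint all commute. A character `ω` of
the algebra they generate with `ω ((U a - 1) * T) ≠ 0` restricts to `x ↦ ω (U x)`, which is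
nontrivial at `a`. The factor `T` is there to force continuity. -/
theorem exists_character_apply_ne_one [IsTopologicalGroup K]
    (hU : ∀ v, Continuous fun x => (U x : H →L[ℂ] H) v) {a : K} (ha : U a ≠ 1) :
    ∃ χ : K →ₜ* Circle, χ a ≠ 1 := by
  borelize K
  let μ : Measure K := Measure.haar
  obtain ⟨v, hv⟩ : ∃ v, (U a : H →L[ℂ] H) v - v ≠ 0 := by
    by_contra! h
    exact ha (Subtype.ext (ContinuousLinearMap.ext fun v => sub_eq_zero.1 (h v)))
  obtain ⟨f, hf⟩ := exists_integratedForm_apply_ne_zero U μ hU hv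
  set T := integratedForm μ U hU f with hT
  let V : K → (H →L[ℂ] H) := fun x => U x
  have hVmul : ∀ x y, V x * V y = V (x * y) := fun x y => by simp [V]
  have hVstar : ∀ x, star (V x) = V x⁻¹ := fun x => by
    simp only [V, map_inv]; rfl
  have hVV : ∀ x y, Commute (V x) (V y) := fun x y => by
    rw [Commute, SemiconjBy, hVmul, hVmul, mul_comm]
  have hVT : ∀ x, Commute (V x) T := fun x => commute_integratedForm μ U hU f _ (hVV x)
  have hVsT : ∀ x, Commute (V x) (star T) := fun x => by
    have := (hVT x⁻¹).star_star
    rwa [hVstar, inv_inv] at this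
  have hTsT : Commute T (star T) :=
    (commute_integratedForm μ U hU f _ fun x => (hVsT x).symm).symm
  let s : Set (H →L[ℂ] H) := insert T (Set.range V)
  have hTmem : T ∈ StarAlgebra.adjoin ℂ s := StarAlgebra.subset_adjoin ℂ s (Set.mem_insert _ _)
  have hVmem : ∀ x, V x ∈ StarAlgebra.adjoin ℂ s := fun x =>
    StarAlgebra.subset_adjoin ℂ s (Set.mem_insert_of_mem _ ⟨x, rfl⟩)
  have hne : (V a - 1) * T ≠ 0 := fun h => by
    apply hf
    have h1 : T * (V a - 1) = 0 := by
      rw [← h, sub_mul, mul_sub, (hVT a).eq, one_mul, mul_one]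
    exact congrArg (fun S : H →L[ℂ] H => S v) h1
  obtain ⟨ω, hω, hne'⟩ := CStarAlgebra.exists_algHom_apply_ne_zero (s := s)
    (by
      rintro _ (rfl | ⟨x, rfl⟩) _ (rfl | ⟨y, rfl⟩)
      exacts [rfl, (hVT y).eq.symm, (hVT x).eq, (hVV x y).eq])
    (by
      rintro _ (rfl | ⟨x, rfl⟩) _ (rfl | ⟨y, rfl⟩)
      · exact hTsT.eq
      · rw [hVstar]; exact (hVT _).eq.symm
      · exact (hVsT x).eq
      · rw [hVstar]; exact (hVV _ _).eq)
    (mul_mem (sub_mem (hVmem a) (one_mem _)) hTmem) hne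
  let W : K →* StarAlgebra.adjoin ℂ s :=
    { toFun := fun x => ⟨V x, hVmem x⟩
      map_one' := Subtype.ext (by simp [V])
      map_mul' := fun x y => Subtype.ext (hVmul x y).symm }
  let T' : StarAlgebra.adjoin ℂ s := ⟨T, hTmem⟩
  have hsplit : ω ((W a - 1) * T') ≠ 0 := hne'
  rw [map_mul, map_sub, map_one] at hsplit
  have hT0 := right_ne_zero_of_mul hsplit
  have ha1 := left_ne_zero_of_mul hsplit
  have hcont : Continuous fun x => ω (W x) := by
    -- `V` need not be norm continuous, but `x ↦ V x * T` is; dividing by `ω T' ≠ 0` recovers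
    -- continuity of `ω (W x)`.
    have h1 : Continuous fun x => ω (W x * T') := by
      refine hω.comp (continuous_induced_rng.2 ?_)
      have : (fun x => V x * T) = fun x => integratedForm μ U hU
          (f.comp (ContinuousMap.mulLeft x⁻¹)) := funext fun x => mul_integratedForm μ U hU f x
      change Continuous fun x => V x * T
      rw [this]
      refine (integratedForm μ U hU).continuous.comp ?_
      exact ContinuousMap.continuous_of_continuous_uncurry _
        (f.continuous.comp (by fun_prop : Continuous fun p : K × K => p.1⁻¹ * p.2))
    simp_rw [map_mul] at h1
    simpa [hT0] using h1.div_const (ω T')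
  let χ : K →* ℂ := (ω : StarAlgebra.adjoin ℂ s →* ℂ).comp W
  have hbdd : ∃ C, ∀ x, ‖χ x‖ ≤ C := by
    obtain ⟨C, hC⟩ := (isCompact_range hcont).isBounded.exists_norm_le
    exact ⟨C, fun x => hC _ ⟨x, rfl⟩⟩
  -- A value of modulus above `1` would have unbounded powers. Applied to `x` and `x⁻¹`, the bound
  -- gives modulus exactly `1`.
  have hle : ∀ x, ‖χ x‖ ≤ 1 := fun x => by
    obtain ⟨C, hC⟩ := hbdd
    by_contra! h
    obtain ⟨n, hn⟩ := pow_unbounded_of_one_lt C h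
    have := hC (x ^ n)
    rw [map_pow, norm_pow] at this
    linarith
  have hnorm : ∀ x, ‖χ x‖ = 1 := fun x => by
    refine le_antisymm (hle x) ?_
    have h1 : ‖χ x‖ * ‖χ x⁻¹‖ = 1 := by rw [← norm_mul, ← map_mul]; simp
    nlinarith [hle x, hle x⁻¹, norm_nonneg (χ x), norm_nonneg (χ x⁻¹)]
  refine ⟨⟨⟨⟨fun x => ⟨χ x, mem_sphere_zero_iff_norm.2 (hnorm x)⟩, ?_⟩, ?_⟩, ?_⟩, ?_⟩
  · exact Subtype.ext (map_one χ)
  · exact fun x y => Subtype.ext (map_mul χ x y)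
  · exact continuous_induced_rng.2 hcont
  · exact fun h => ha1 (sub_eq_zero.2 (congrArg Subtype.val h))

end UnitaryRep

end

/-! ### The regular representation, and separation of points by characters. -/

section

open MeasureTheory
open scoped ENNReal

/-- The regular representation of a commutative group on `L²`. -/
noncomputable def regularRepresentation (K : Type*) [CommGroup K] [MeasurableSpace K]
    [MeasurableMul K] (μ : Measure K) [μ.IsMulLeftInvariant] :
    K →* unitary (Lp ℂ 2 μ →L[ℂ] Lp ℂ 2 μ) :=
  (Unitary.linearIsometryEquiv (𝕜 := ℂ) (H := Lp ℂ 2 μ)).symm.toMonoidHom.comp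
    { toFun := fun x =>
        { toFun := fun v => DomMulAct.mk x • v
          invFun := fun v => DomMulAct.mk x⁻¹ • v
          map_add' := fun v w => smul_add _ v w
          map_smul' := fun c v => smul_comm _ c v
          left_inv := fun v => by
            change DomMulAct.mk x⁻¹ • DomMulAct.mk x • v = v
            rw [smul_smul, ← DomMulAct.mk_mul]; simp
          right_inv := fun v => by
            change DomMulAct.mk x • DomMulAct.mk x⁻¹ • v = v
            rw [smul_smul, ← DomMulAct.mk_mul]; simp
          norm_map' := fun v => DomMulAct.norm_smul_Lp _ v }
      map_one' := by
        ext1 v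
        exact one_smul Kᵈᵐᵃ v
      -- `DomMulAct` reverses products, so commutativity is needed here.
      map_mul' := fun x y => by
        ext1 v
        change DomMulAct.mk (x * y) • v = DomMulAct.mk x • DomMulAct.mk y • v
        rw [smul_smul, ← DomMulAct.mk_mul, mul_comm] }

/-- Characters separate the points of a compact abelian group. -/
theorem exists_character_ne_one {K : Type*} [CommGroup K] [TopologicalSpace K]
    [IsTopologicalGroup K] [CompactSpace K] [T2Space K] {a : K} (ha : a ≠ 1) :
    ∃ χ : K →ₜ* Circle, χ a ≠ 1 := by
  borelize K
  let μ : Measure K := Measure.haar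
  refine UnitaryRep.exists_character_apply_ne_one (regularRepresentation K μ) (fun v => ?_) ?_
  · have : Fact ((2 : ℝ≥0∞) ≠ ∞) := ⟨by simp⟩
    have h1 : Continuous fun x : K => DomMulAct.mk x • v :=
      (DomMulAct.continuous_mk).smul continuous_const
    exact h1
  · intro h
    -- If `a` acted trivially, a continuous function would agree with its translate by `a` almost
    -- everywhere, hence everywhere. A Urysohn function separating `1` from `a` does not.
    obtain ⟨u, hu0, hu1, -⟩ := exists_continuous_zero_one_of_isClosed
      (isClosed_singleton (x := (1 : K))) (isClosed_singleton (x := a))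
      (Set.disjoint_singleton.2 ha.symm)
    let f : K → ℂ := fun x => u x
    have hf : Continuous f := by fun_prop
    have hfL : MemLp f 2 μ := hf.memLp_of_hasCompactSupport (HasCompactSupport.of_compactSpace _)
    have h1 : DomMulAct.mk a • hfL.toLp f = hfL.toLp f :=
      congrArg (fun S : unitary (Lp ℂ 2 μ →L[ℂ] Lp ℂ 2 μ) =>
        (S : Lp ℂ 2 μ →L[ℂ] Lp ℂ 2 μ) (hfL.toLp f)) h
    rw [DomMulAct.mk_smul_toLp, MemLp.toLp_eq_toLp_iff] at h1
    have h2 := congrFun (Continuous.ae_eq_iff_eq μ (hf.comp (continuous_const_smul a)) hf |>.1 h1) 1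
    have h3 : u a = 1 := hu1 rfl
    have h4 : u 1 = 0 := hu0 rfl
    simp [f, h3, h4] at h2

/-! ### Density of subgroups in the dual of a discrete group. -/

/-- Integration of a continuous function over a compact subgroup translated by `x`. -/
noncomputable def cosetIntegral {G : Type*} [Group G] [TopologicalSpace G] [IsTopologicalGroup G]
    [CompactSpace G] (H : Subgroup G) [CompactSpace H] [MeasurableSpace H] [BorelSpace H]
    (μ : Measure H) [IsFiniteMeasure μ] (x : G) : C(G, ℂ) →L[ℂ] ℂ :=
  have hint (g : C(G, ℂ)) : Integrable (fun h : H => g (x * h)) μ :=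
    (by fun_prop : Continuous fun h : H => g (x * h)).integrable_of_hasCompactSupport
      (HasCompactSupport.of_compactSpace _)
  LinearMap.mkContinuous
    { toFun := fun g => ∫ h : H, g (x * h) ∂μ
      map_add' := fun f g => integral_add (hint f) (hint g)
      map_smul' := fun c f => integral_const_mul c _ }
    (μ.real Set.univ)
    (fun g => (norm_integral_le_of_norm_le_const (μ := μ)
      (Filter.Eventually.of_forall fun h : H => g.norm_coe_le_norm (x * h))).trans
        (mul_comm _ _).le)

theorem cosetIntegral_apply {G : Type*} [Group G] [TopologicalSpace G] [IsTopologicalGroup G]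
    [CompactSpace G] (H : Subgroup G) [CompactSpace H] [MeasurableSpace H] [BorelSpace H]
    (μ : Measure H) [IsFiniteMeasure μ] (x : G) (g : C(G, ℂ)) :
    cosetIntegral H μ x g = ∫ h : H, g (x * h) ∂μ := rfl

namespace PontryaginDual

variable {F : Type*} [CommGroup F] [TopologicalSpace F]

/-- Evaluation at an element of the group, as a complex-valued function on the dual. -/
noncomputable def evalHom : F →* C(PontryaginDual F, ℂ) where
  toFun f := ⟨fun χ => (χ f : ℂ), by
    have : Continuous fun χ : F →ₜ* Circle => χ f :=
      (ContinuousEvalConst.continuous_eval_const (F := C(F, Circle)) f).comp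
        (ContinuousMonoidHom.isInducing_toContinuousMap F Circle).continuous
    exact continuous_subtype_val.comp this⟩
  map_one' := by ext χ; simp
  map_mul' f g := by ext χ; simp

theorem evalHom_apply (f : F) (χ : PontryaginDual F) : evalHom f χ = (χ f : ℂ) := rfl

theorem star_evalHom (f : F) : star (evalHom f) = evalHom f⁻¹ := by
  ext χ
  simp only [ContinuousMap.star_apply, evalHom_apply, map_inv, Circle.coe_inv_eq_conj]
  rfl

/-- Trigonometric polynomials are dense in the continuous functions on the dual of a discrete
group. -/
theorem closure_span_evalHom [DiscreteTopology F] :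
    closure (Submodule.span ℂ (Set.range (evalHom (F := F))) : Set C(PontryaginDual F, ℂ)) =
      Set.univ := by
  let P := StarAlgebra.adjoin ℂ (Set.range (evalHom (F := F)))
  have hspan : (P : Set C(PontryaginDual F, ℂ)) =
      Submodule.span ℂ (Set.range (evalHom (F := F))) := by
    -- Evaluations are closed under products and conjugation, so their span is already a star
    -- algebra.
    have h1 : star (Set.range (evalHom (F := F))) ⊆ Set.range (evalHom (F := F)) := by
      rintro g ⟨f, hf⟩
      exact ⟨f⁻¹, by rw [← star_evalHom, hf, star_star]⟩
    have h2 : Submonoid.closure (Set.range (evalHom (F := F))) = MonoidHom.mrange evalHom :=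
      Submonoid.closure_eq (MonoidHom.mrange evalHom)
    rw [← StarSubalgebra.coe_toSubalgebra, StarAlgebra.adjoin_toSubalgebra,
      Set.union_eq_self_of_subset_right h1, ← Subalgebra.coe_toSubmodule,
      Algebra.adjoin_eq_span, h2]
    rfl
  have hP : P.topologicalClosure = ⊤ := by
    refine ContinuousMap.starSubalgebra_topologicalClosure_eq_top_of_separatesPoints P ?_
    intro χ ψ hne
    obtain ⟨f, hf⟩ : ∃ f, χ f ≠ ψ f := by
      by_contra! h
      exact hne (PontryaginDual.ext h)
    exact ⟨_, ⟨evalHom f, StarAlgebra.subset_adjoin ℂ _ ⟨f, rfl⟩, rfl⟩,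
      fun h => hf (Subtype.ext h)⟩
  rw [← hspan, ← StarSubalgebra.topologicalClosure_coe, hP]
  rfl

/-- A subgroup of the dual of a discrete group is dense if no nontrivial evaluation is trivial
on it. -/
theorem dense_of_forall_apply_eq_one [DiscreteTopology F] (S : Subgroup (PontryaginDual F))
    (hS : ∀ f : F, (∀ χ ∈ S, χ f = 1) → f = 1) : Dense (S : Set (PontryaginDual F)) := by
  let H : Subgroup (PontryaginDual F) := S.topologicalClosure
  have hHcl : IsClosed (H : Set (PontryaginDual F)) := S.isClosed_topologicalClosure
  rw [dense_iff_closure_eq, Set.eq_univ_iff_forall]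
  intro χ₀
  by_contra hχ₀
  have hχ₀' : χ₀ ∉ H := hχ₀
  have : CompactSpace H := isCompact_iff_compactSpace.1 hHcl.isCompact
  let : MeasurableSpace H := borel H
  have : BorelSpace H := ⟨rfl⟩
  let μ : Measure H := Measure.haar
  have hev : ∀ f, cosetIntegral H μ χ₀ (evalHom f) = cosetIntegral H μ 1 (evalHom f) := by
    intro f
    have h1 : ∀ x, cosetIntegral H μ x (evalHom f) =
        x f * cosetIntegral H μ 1 (evalHom f) := fun x => by
      simp only [cosetIntegral_apply, evalHom_apply, one_mul]
      rw [← integral_const_mul]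
      refine integral_congr_ae (.of_forall fun h => ?_)
      exact Circle.coe_mul _ _
    by_cases hf : f = 1
    · rw [h1, hf, _root_.map_one, Circle.coe_one, one_mul]
    · obtain ⟨χ, hχ, hne⟩ : ∃ χ ∈ S, χ f ≠ 1 := by
        by_contra! h
        exact hf (hS f h)
      -- Translation by `χ ∈ S` preserves the integral but also multiplies it by `χ f ≠ 1`, so the
      -- integral vanishes.
      have h2 : cosetIntegral H μ χ (evalHom f) = cosetIntegral H μ 1 (evalHom f) := by
        simp only [cosetIntegral_apply, one_mul]
        exact integral_mul_left_eq_self (fun h : H => evalHom f (h : PontryaginDual F))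
          (⟨χ, S.le_topologicalClosure hχ⟩ : H)
      have h3 : cosetIntegral H μ 1 (evalHom f) = 0 := by
        rw [h1 χ] at h2
        by_contra h0
        exact hne (Subtype.ext ((mul_eq_right₀ h0).1 h2))
      rw [h1, h3, mul_zero]
  have hall : ∀ g, cosetIntegral H μ χ₀ g = cosetIntegral H μ 1 g := by
    intro g
    have hcl : IsClosed {g | cosetIntegral H μ χ₀ g = cosetIntegral H μ 1 g} :=
      isClosed_eq (cosetIntegral H μ χ₀).continuous (cosetIntegral H μ 1).continuous
    refine hcl.closure_subset_iff.2 ?_ (closure_span_evalHom.ge (Set.mem_univ g))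
    intro g hg
    refine LinearMap.eqOn_span (f := (cosetIntegral H μ χ₀).toLinearMap)
      (g := (cosetIntegral H μ 1).toLinearMap) ?_ hg
    rintro _ ⟨f, rfl⟩
    exact hev f
  -- `H` and `χ₀ H` are disjoint closed sets; a function equal to `0` on one and `1` on the other
  -- has integrals `0` and `μ(H) ≠ 0`.
  obtain ⟨u, hu0, hu1, -⟩ := exists_continuous_zero_one_of_isClosed hHcl
    ((Homeomorph.mulLeft χ₀).isClosedMap _ hHcl) (by
      rw [Set.disjoint_left]
      rintro x hx ⟨y, hy, rfl⟩
      exact hχ₀' ((H.mul_mem_cancel_right hy).1 hx))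
  have key := hall ⟨fun χ => u χ, by fun_prop⟩
  have h1 : ∀ h : H, u (χ₀ * h) = 1 := fun h => hu1 ⟨h, h.2, rfl⟩
  have h0 : ∀ h : H, u h = 0 := fun h => hu0 h.2
  have hμ : μ.real Set.univ ≠ 0 := by
    rw [measureReal_ne_zero_iff]
    exact isOpen_univ.measure_ne_zero μ Set.univ_nonempty
  simp [cosetIntegral_apply, h1, h0] at key
  exact hμ (by exact_mod_cast key)

end PontryaginDual

end

/-! ### Ultrapowers, Łoś's theorem and existence of saturated extensions. -/

section

open Filter Topology

namespace ContLogic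

theorem Formula.norm_eval_le_iSup {F : Type u} {N : Type w} {α : Type v} (M : Str F N)
    (val : α → N) {n : ℕ} (φ : Formula F α (n + 1)) (xs : Fin n → N) (x : N) :
    ‖φ.eval M val (Fin.snoc xs x : Fin (n + 1) → N)‖ ≤
      ⨆ x : N, ‖φ.eval M val (Fin.snoc xs x : Fin (n + 1) → N)‖ := by
  obtain ⟨C, hC⟩ := φ.eval_bounded
  exact le_ciSup (f := fun x => ‖φ.eval M val (Fin.snoc xs x : Fin (n + 1) → N)‖)
    ⟨C, by rintro _ ⟨y, rfl⟩; exact hC N M val _⟩ x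

theorem Formula.iInf_le_norm_eval {F : Type u} {N : Type w} {α : Type v} (M : Str F N)
    (val : α → N) {n : ℕ} (φ : Formula F α (n + 1)) (xs : Fin n → N) (x : N) :
    ⨅ x : N, ‖φ.eval M val (Fin.snoc xs x : Fin (n + 1) → N)‖ ≤
      ‖φ.eval M val (Fin.snoc xs x : Fin (n + 1) → N)‖ :=
  ciInf_le (f := fun x => ‖φ.eval M val (Fin.snoc xs x : Fin (n + 1) → N)‖)
    ⟨0, by rintro _ ⟨y, rfl⟩; exact norm_nonneg _⟩ x

section Ultrapower

variable {F : Type u} {N : Type w} (M : Str F N) {I : Type v} (U : Ultrafilter I)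

/-- The ultrapower of a structure; its predicates are the ultralimits. -/
noncomputable def Str.ultrapower : Str F (Germ (U : Filter I) N) where
  zero := ↑(fun _ => M.zero : I → N)
  add := Germ.map₂ M.add
  neg := Germ.map M.neg
  pred f := Quotient.lift (fun x : I → N => (U.map fun i => M.pred f (x i)).lim) (by
    intro x y h
    have : U.map (fun i => M.pred f (x i)) = U.map (fun i => M.pred f (y i)) :=
      Ultrafilter.coe_injective (Filter.map_congr
        (Filter.Eventually.mono (h : x =ᶠ[(U : Filter I)] y) fun i hi => congrArg (M.pred f) hi))
    simp only [this])

/-- Compactness of the circle makes every ultrafilter on it converge to its `lim`. -/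
theorem tendsto_pred (f : F) (x : I → N) :
    Tendsto (fun i => M.pred f (x i)) U (𝓝 ((M.ultrapower U).pred f (x : Germ (U : Filter I) N))) :=
  (U.map fun i => M.pred f (x i)).le_nhds_lim

theorem eval_term_ultrapower {V : Type*} (t : Term V) (x : V → I → N) :
    t.eval (M.ultrapower U) (fun k => (x k : Germ (U : Filter I) N)) =
      ((fun i => t.eval M fun k => x k i : I → N) : Germ (U : Filter I) N) := by
  induction t with
  | var x => rfl
  | zero => rfl
  | add s t hs ht => simp only [Term.eval, hs, ht]; rfl
  | neg t ht => simp only [Term.eval, ht]; rfl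

theorem sumElim_coe {α β : Type*} (x : α → I → N) (y : β → I → N) :
    Sum.elim (fun k => (x k : Germ (U : Filter I) N)) (fun k => (y k : Germ (U : Filter I) N)) =
      fun k => ((Sum.elim x y k : I → N) : Germ (U : Filter I) N) := by
  funext k
  cases k <;> rfl

theorem snoc_coe {n : ℕ} (xs : Fin n → I → N) (x : I → N) :
    (Fin.snoc (fun k => (xs k : Germ (U : Filter I) N)) (x : Germ (U : Filter I) N) :
      Fin (n + 1) → Germ (U : Filter I) N) =
      fun k => (((Fin.snoc xs x : Fin (n + 1) → I → N) k : I → N) : Germ (U : Filter I) N) := by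
  funext k
  refine Fin.lastCases ?_ (fun j => ?_) k <;> simp

theorem snoc_apply {n : ℕ} (xs : Fin n → I → N) (x : I → N) (i : I) :
    (fun k => (Fin.snoc xs x : Fin (n + 1) → I → N) k i) =
      (Fin.snoc (fun k => xs k i) (x i) : Fin (n + 1) → N) := by
  funext k
  refine Fin.lastCases ?_ (fun j => ?_) k <;> simp

theorem sumElim_apply {α β : Type*} (x : α → I → N) (y : β → I → N) (i : I) :
    (fun k => Sum.elim x y k i) = Sum.elim (fun k => x k i) (fun k => y k i) := by
  funext k
  cases k <;> rfl

/-- Łoś's theorem: the value of a formula in an ultrapower is the ultralimit of its values. -/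
theorem tendsto_eval_ultrapower {α : Type*} {n : ℕ} (φ : Formula F α n) (val : α → I → N)
    (xs : Fin n → I → N) :
    Tendsto (fun i => φ.eval M (fun k => val k i) fun k => xs k i) U
      (𝓝 (φ.eval (M.ultrapower U) (fun k => (val k : Germ (U : Filter I) N))
        fun k => (xs k : Germ (U : Filter I) N))) := by
  induction φ with
  | eq s t =>
    simp only [Formula.eval]
    refine tendsto_const_nhds.congr' ?_
    split_ifs with h
    · rw [sumElim_coe, eval_term_ultrapower, eval_term_ultrapower, Germ.coe_eq] at h
      filter_upwards [h] with i hi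
      rw [sumElim_apply] at hi
      rw [if_pos hi]
    · rw [sumElim_coe, eval_term_ultrapower, eval_term_ultrapower, Germ.coe_eq] at h
      filter_upwards [Ultrafilter.eventually_not.2 h] with i hi
      rw [sumElim_apply] at hi
      rw [if_neg hi]
  | pred f t =>
    simp only [Formula.eval, sumElim_coe, eval_term_ultrapower, ← sumElim_apply]
    exact (continuous_subtype_val.tendsto _).comp (tendsto_pred M U f _)
  | conn c φ ih =>
    simp only [Formula.eval]
    exact (c.continuous.tendsto _).comp (tendsto_pi_nhds.2 fun k => ih k xs)
  | sup φ ih =>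
    simp only [Formula.eval]
    refine (Complex.continuous_ofReal.tendsto _).comp ?_
    have : Nonempty N := ⟨M.zero⟩
    have : Nonempty (Germ (U : Filter I) N) := ⟨(M.ultrapower U).zero⟩
    have hlim := fun x : I → N => (ih (Fin.snoc xs x)).norm
    simp only [snoc_apply, ← snoc_coe] at hlim
    refine tendsto_order.2 ⟨fun a ha => ?_, fun a ha => ?_⟩
    · obtain ⟨y, hy⟩ := exists_lt_of_lt_ciSup ha
      induction y using Germ.inductionOn with | _ x =>
      filter_upwards [(hlim x).eventually_const_lt hy] with i hi
      exact hi.trans_le (φ.norm_eval_le_iSup M _ _ _)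
    · obtain ⟨b, hb, hba⟩ := exists_between ha
      -- Elements within `a - b` of each coordinate supremum define an ultrapower element whose
      -- value is below `b`; hence the coordinate suprema are eventually below `b + (a - b) = a`.
      have hx : ∀ i, ∃ x : N, (⨆ x : N, ‖φ.eval M (fun k => val k i)
          (Fin.snoc (fun k => xs k i) x : Fin _ → N)‖) - (a - b) <
          ‖φ.eval M (fun k => val k i) (Fin.snoc (fun k => xs k i) x : Fin _ → N)‖ :=
        fun i => exists_lt_of_lt_ciSup (by linarith)
      choose x hx using hx
      filter_upwards [(hlim x).eventually_lt_const
        ((φ.norm_eval_le_iSup (M.ultrapower U) _ _ _).trans_lt hb)] with i hi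
      have := hx i
      linarith
  | inf φ ih =>
    simp only [Formula.eval]
    refine (Complex.continuous_ofReal.tendsto _).comp ?_
    have : Nonempty N := ⟨M.zero⟩
    have : Nonempty (Germ (U : Filter I) N) := ⟨(M.ultrapower U).zero⟩
    have hlim := fun x : I → N => (ih (Fin.snoc xs x)).norm
    simp only [snoc_apply, ← snoc_coe] at hlim
    refine tendsto_order.2 ⟨fun a ha => ?_, fun a ha => ?_⟩
    · obtain ⟨b, hba, hb⟩ := exists_between ha
      have hx : ∀ i, ∃ x : N,
          ‖φ.eval M (fun k => val k i) (Fin.snoc (fun k => xs k i) x : Fin _ → N)‖ <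
          (⨅ x : N, ‖φ.eval M (fun k => val k i)
          (Fin.snoc (fun k => xs k i) x : Fin _ → N)‖) + (b - a) :=
        fun i => exists_lt_of_ciInf_lt (by linarith)
      choose x hx using hx
      filter_upwards [(hlim x).eventually_const_lt
        (hb.trans_le (φ.iInf_le_norm_eval (M.ultrapower U) _ _ _))] with i hi
      have := hx i
      linarith
    · obtain ⟨y, hy⟩ := exists_lt_of_ciInf_lt ha
      induction y using Germ.inductionOn with | _ x =>
      filter_upwards [(hlim x).eventually_lt_const hy] with i hi
      exact (φ.iInf_le_norm_eval M _ _ _).trans_lt hi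

theorem isElementary_ultrapower :
    IsElementary M (M.ultrapower U) fun a => ((fun _ => a : I → N) : Germ (U : Filter I) N) := by
  intro n φ a
  have h := tendsto_eval_ultrapower M U φ (fun k => Empty.elim k) (fun k _ => a k)
  have h1 : (fun k : Empty => Empty.elim k) = (Empty.elim : Empty → N) := funext fun k => k.elim
  have h2 : (fun k : Empty => ((Empty.elim k : I → N) : Germ (U : Filter I) N)) = Empty.elim :=
    funext fun k => k.elim
  have h3 : ∀ i : I, (fun k : Empty => (Empty.elim k : I → N) i) = (Empty.elim : Empty → N) :=
    fun i => funext fun k => k.elim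
  simp only [h2, h3] at h
  exact tendsto_nhds_unique h tendsto_const_nhds

end Ultrapower

/-- Every structure has an elementary extension saturated over it. -/
theorem exists_isSaturatedOver {F : Type u} {A : Type u} (M : Str F A) :
    ∃ (N : Type u) (M' : Str F N) (i : A → N), IsElementary M M' i ∧ IsSaturatedOver M' i := by
  classical
  -- An index is a finite set of formulas with a tolerance; `U` contains every cone of this directed
  -- set.
  let I := Finset (Σ n, Formula F A n) × ℕ
  let U : Ultrafilter I := Ultrafilter.of atTop
  have hU : (U : Filter I) ≤ atTop := Ultrafilter.of_le _
  refine ⟨_, M.ultrapower U, _, isElementary_ultrapower M U, fun n Γ hΓ => ?_⟩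
  -- An exact solution of finitely many conditions in the ultrapower descends, by Łoś, to
  -- approximate solutions in `A`. Letting the index `d` vary, these then assemble into a solution
  -- of all of `Γ`.
  have happrox : ∀ d : I, ∃ x : Fin n → A, ∀ φ : Formula F A n, ⟨n, φ⟩ ∈ d.1 → φ ∈ Γ →
      ‖φ.eval M id x‖ < 1 / (d.2 + 1 : ℝ) := by
    intro d
    let Δ : Finset (Formula F A n) :=
      (d.1.preimage (Sigma.mk n) sigma_mk_injective.injOn).filter (· ∈ Γ)
    obtain ⟨y, hy⟩ := hΓ Δ fun φ hφ => (Finset.mem_filter.1 hφ).2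
    choose xs hxs using fun k => (y k).exists_rep
    have hev : ∀ᶠ i in (U : Filter I), ∀ φ ∈ Δ,
        ‖φ.eval M id fun k => xs k i‖ < 1 / (d.2 + 1 : ℝ) := by
      rw [Filter.eventually_all_finset]
      intro φ hφ
      have h := (tendsto_eval_ultrapower M U φ (fun a _ => a) xs).norm
      have h0 : φ.eval (M.ultrapower U) (fun a => ((fun _ => a : I → A) : Germ (U : Filter I) A))
          (fun k => (xs k : Germ (U : Filter I) A)) = 0 := by
        rw [← hy φ hφ]
        congr 1
        exact funext hxs
      rw [h0, norm_zero] at h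
      exact h.eventually_lt_const (by positivity)
    obtain ⟨i, hi⟩ := hev.exists
    exact ⟨fun k => xs k i, fun φ h1 h2 => hi φ (by simp [Δ, h1, h2])⟩
  choose x hx using happrox
  refine ⟨fun k => ((fun d => x d k : I → A) : Germ (U : Filter I) A), fun φ hφ => ?_⟩
  have h := (tendsto_eval_ultrapower M U φ (fun a _ => a) fun k d => x d k).norm
  rw [← norm_eq_zero]
  refine le_antisymm (le_of_forall_pos_le_add fun ε hε => ?_) (norm_nonneg _)
  obtain ⟨m, hm⟩ := exists_nat_one_div_lt hε
  rw [zero_add]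
  refine le_of_tendsto h ?_
  filter_upwards [hU (eventually_ge_atTop (({⟨n, φ⟩}, m) : I))] with d hd
  have h1 := hx d φ (hd.1 (Finset.mem_singleton_self _)) hφ
  have h2 : 1 / (d.2 + 1 : ℝ) ≤ 1 / (m + 1 : ℝ) := by
    have : (m : ℝ) ≤ d.2 := by exact_mod_cast hd.2
    gcongr
  exact (h1.le.trans h2).trans hm.le

end ContLogic

end

/-! ### A criterion for being the Bohr compactification. -/

section

open Topology

/-- A continuous homomorphism with dense range to a compact abelian group, through which all
characters factor, is the Bohr compactification. -/
theorem isBohrCompactification_of_denseRange {A : Type u} [AddCommGroup A] [TopologicalSpace A]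
    {C : Type v} [AddCommGroup C] [TopologicalSpace C] [IsTopologicalAddGroup C] [CompactSpace C]
    [T2Space C] (j : A →ₜ+ C) (hj : DenseRange j)
    (hext : ∀ f : CharGroup A, ∃ E : C → Circle, Continuous E ∧ ∀ a, E (j a) = f.app a) :
    IsBohrCompactification.{u, v, w} j := by
  refine ⟨inferInstance, inferInstance, inferInstance, ?_⟩
  intro D _ _ _ _ _ g
  let R : AddSubgroup D := (g : A →+ D).range
  -- Only this closure matters: it is commutative, as the closure of an image of `A`, even when `D`
  -- is not.
  let K : AddSubgroup D := R.topologicalClosure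
  have hKcl : IsClosed (K : Set D) := R.isClosed_topologicalClosure
  have : CompactSpace K := isCompact_iff_compactSpace.1 hKcl.isCompact
  let _ : AddCommGroup K := R.addCommGroupTopologicalClosure (by
    rintro ⟨_, a, rfl⟩ ⟨_, b, rfl⟩
    refine Subtype.ext ?_
    change g a + g b = g b + g a
    rw [← map_add, add_comm, map_add])
  let gK : A →ₜ+ K :=
    { toFun := fun a => ⟨g a, R.le_topologicalClosure ⟨a, rfl⟩⟩
      map_zero' := Subtype.ext (map_zero g)
      map_add' := fun a b => Subtype.ext (map_add g a b)
      continuous_toFun := continuous_induced_rng.2 (map_continuous g) }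
  let X := Multiplicative K →ₜ* Circle
  let Φ : K → X → Circle := fun k ψ => ψ (Multiplicative.ofAdd k)
  have hΦc : Continuous Φ :=
    continuous_pi fun ψ => (map_continuous ψ).comp continuous_ofAdd
  have hΦi : Function.Injective Φ := fun k l hkl => by
    by_contra hne
    have hne' : Multiplicative.ofAdd k / Multiplicative.ofAdd l ≠ 1 := fun h =>
      hne (Multiplicative.ofAdd.injective (div_eq_one.1 h))
    have : T2Space (Multiplicative K) := inferInstanceAs (T2Space K)
    obtain ⟨χ, hχ⟩ := exists_character_ne_one hne'
    exact hχ (by rw [map_div, div_eq_one]; exact congrFun hkl χ)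
  have hΦ : IsClosedEmbedding Φ := hΦc.isClosedEmbedding hΦi
  have hpull : ∀ ψ : X, ∃ E : C → Circle, Continuous E ∧
      ∀ a, E (j a) = ψ (Multiplicative.ofAdd (gK a)) := fun ψ =>
    hext (ψ.comp ⟨AddMonoidHom.toMultiplicative (gK : A →+ K),
      continuous_ofAdd.comp ((map_continuous gK).comp continuous_toAdd)⟩ : Multiplicative A →ₜ* Circle)
  choose E hEc hE using hpull
  let Ψ : C → X → Circle := fun c ψ => E ψ c
  have hΨc : Continuous Ψ := continuous_pi hEc
  have hΨj : ∀ a, Φ (gK a) = Ψ (j a) := fun a => funext fun ψ => (hE ψ a).symm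
  -- The range of `Φ` is closed and contains `Ψ` on the dense image of `j`, so `Ψ` lifts through `Φ`
  -- to a map into `K`.
  have hmem : ∀ c, Ψ c ∈ Set.range Φ := fun c =>
    hj.induction_on c (hΦ.isClosed_range.preimage hΨc) fun a => ⟨gK a, hΨj a⟩
  choose h hh using hmem
  have hhj : ∀ a, h (j a) = gK a := fun a => hΦi ((hh _).trans (hΨj a).symm)
  have hhc : Continuous h := hΦ.continuous_iff.2 (by
    rw [show Φ ∘ h = Ψ from funext hh]; exact hΨc)
  have hadd : ∀ c d, h (c + d) = h c + h d := fun c d =>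
    hj.induction_on₂ (p := fun c d => h (c + d) = h c + h d)
      (isClosed_eq (by fun_prop) (by fun_prop)) (fun a b => by
        rw [← map_add, hhj, hhj, hhj, map_add]) c d
  let k : C →ₜ+ D :=
    { toFun := fun c => h c
      map_zero' := by
        have := hhj 0
        rw [map_zero, map_zero] at this
        rw [this]; rfl
      map_add' := fun c d => congrArg Subtype.val (hadd c d)
      continuous_toFun := continuous_subtype_val.comp hhc }
  have hk : ∀ a, k (j a) = g a := fun a => congrArg Subtype.val (hhj a)
  refine ⟨k, hk, fun l hl => ?_⟩
  refine DFunLike.coe_injective (hj.equalizer (map_continuous l) (map_continuous k) ?_)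
  exact funext fun a => (hl a).trans (hk a).symm

/-! ### Transfer to elementary extensions, realization of types, and the type space. -/

namespace ContLogic

section Elementary

variable {F : Type u} {A : Type v} {N : Type w} {M : Str F A} {M' : Str F N} {i : A → N}

/-- Elementarity speaks only of tuples from `A`. Binding the variables one at a time by `sup` turns
the identity into a sentence, whose value `0` bounds `φ` at every tuple of `N`. -/
theorem IsElementary.eval_eq_zero (h : IsElementary M M' i) {n : ℕ} (φ : Formula F Empty n)
    (hφ : ∀ xs, φ.eval M Empty.elim xs = 0) (xs : Fin n → N) : φ.eval M' Empty.elim xs = 0 := by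
  induction n with
  | zero =>
    have h1 := h 0 φ Fin.elim0
    rwa [hφ, Subsingleton.elim (fun k => i (Fin.elim0 k)) xs] at h1
  | succ n ih =>
    have h1 := ih (.sup φ) (fun ys => by simp [Formula.eval, hφ]) (Fin.init xs)
    simp only [Formula.eval, Complex.ofReal_eq_zero] at h1
    have h2 := φ.norm_eval_le_iSup M' Empty.elim (Fin.init xs) (xs (Fin.last n))
    rwa [h1, Fin.snoc_init_self, norm_le_zero_iff] at h2

theorem IsElementary.pred_apply (h : IsElementary M M' i) (f : F) (a : A) :
    M'.pred f (i a) = M.pred f a :=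
  Subtype.ext (h 1 (.pred f (.var (.inr 0))) fun _ => a)

/-- The connective `(z₀, z₁, z₂) ↦ z₀ - z₁ z₂`. -/
noncomputable def subMulConn : C(Fin 3 → ℂ, ℂ) := ⟨fun z => z 0 - z 1 * z 2, by fun_prop⟩

theorem IsElementary.pred_add (h : IsElementary M M' i)
    (hM : ∀ f x y, M.pred f (M.add x y) = M.pred f x * M.pred f y) (f : F) (x y : N) :
    M'.pred f (M'.add x y) = M'.pred f x * M'.pred f y := by
  have h1 := h.eval_eq_zero (.conn subMulConn ![.pred f (.add (.var (.inr 0)) (.var (.inr 1))),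
    .pred f (.var (.inr 0)), .pred f (.var (.inr 1))] : Formula F Empty 2)
    (fun xs => by simp [Formula.eval, Term.eval, subMulConn, hM]) ![x, y]
  exact Subtype.ext (by
    simpa [Formula.eval, Term.eval, subMulConn, sub_eq_zero] using h1)

theorem IsElementary.pred_mul [Mul F] (h : IsElementary M M' i)
    (hM : ∀ f g x, M.pred (f * g) x = M.pred f x * M.pred g x) (f g : F) (x : N) :
    M'.pred (f * g) x = M'.pred f x * M'.pred g x := by
  have h1 := h.eval_eq_zero (.conn subMulConn ![.pred (f * g) (.var (.inr 0)),
    .pred f (.var (.inr 0)), .pred g (.var (.inr 0))] : Formula F Empty 1)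
    (fun xs => by simp [Formula.eval, Term.eval, subMulConn, hM]) ![x]
  exact Subtype.ext (by
    simpa [Formula.eval, Term.eval, subMulConn, sub_eq_zero] using h1)

/-- The formula `max(0, |f(x) - z| - ε)`. -/
noncomputable def nearFormula (F : Type u) (A : Type v) (f : F) (z : ℂ) (ε : ℝ) : Formula F A 1 :=
  .conn (k := 1) ⟨fun y => ((max 0 (‖y 0 - z‖ - ε) : ℝ) : ℂ), by fun_prop⟩
    ![.pred f (.var (.inr 0))]

theorem nearFormula_eval (f : F) (z : ℂ) (ε : ℝ) (x : Fin 1 → N) :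
    (nearFormula F A f z ε).eval M' i x = 0 ↔ ‖(M'.pred f (x 0) : ℂ) - z‖ ≤ ε := by
  simp [nearFormula, Formula.eval, Term.eval]

/-- A saturated structure realizes every family of values that is approximately realized in the
substructure. -/
theorem IsSaturatedOver.exists_pred_eq (hs : IsSaturatedOver M' i) (χ : F → Circle)
    (hχ : ∀ (s : Finset F) (ε : ℝ), 0 < ε → ∃ x : N, ∀ f ∈ s, ‖(M'.pred f x - χ f : ℂ)‖ ≤ ε) :
    ∃ x : N, ∀ f, M'.pred f x = χ f := by
  classical
  obtain ⟨x, hx⟩ := hs 1 (Set.range fun q : F × {ε : ℝ // 0 < ε} =>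
    nearFormula F A q.1 (χ q.1) q.2) (fun Δ hΔ => by
      rw [← Set.image_univ] at hΔ
      obtain ⟨s, -, rfl⟩ := Finset.subset_set_image_iff.1 hΔ
      -- Finitely many conditions involve finitely many tolerances, which have a common positive
      -- lower bound.
      obtain ⟨ε, hε, hle⟩ : ∃ ε : ℝ, 0 < ε ∧ ∀ q ∈ s, ε ≤ q.2 := by
        induction s using Finset.induction_on with
        | empty => exact ⟨1, one_pos, by simp⟩
        | insert q s _ ih =>
          obtain ⟨ε, hε, h⟩ := ih (by simp)
          refine ⟨min ε q.2, lt_min hε q.2.2, fun r hr => ?_⟩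
          obtain rfl | hr := Finset.mem_insert.1 hr
          exacts [min_le_right _ _, (min_le_left _ _).trans (h r hr)]
      obtain ⟨x, hx⟩ := hχ (s.image Prod.fst) ε hε
      refine ⟨fun _ => x, fun φ hφ => ?_⟩
      obtain ⟨q, hq, rfl⟩ := Finset.mem_image.1 hφ
      exact (nearFormula_eval _ _ _ _).2
        ((hx q.1 (Finset.mem_image_of_mem _ hq)).trans (hle q hq)))
  refine ⟨x 0, fun f => Subtype.ext (sub_eq_zero.1 (norm_le_zero_iff.1 ?_))⟩
  refine le_of_forall_pos_le_add fun ε hε => ?_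
  rw [zero_add]
  exact (nearFormula_eval _ _ _ _).1 (hx _ ⟨(f, ⟨ε, hε⟩), rfl⟩)

end Elementary

section TypeSpace

variable {F : Type u} {N : Type w} {M' : Str F N}

theorem TypeSpace.continuous_value (f : F) :
    Continuous (TypeSpace.value f : TypeSpace M' → Circle) :=
  continuous_iInf_dom continuous_induced_dom

theorem TypeSpace.continuous_iff {X : Type*} [TopologicalSpace X] {g : X → TypeSpace M'} :
    Continuous g ↔ ∀ f, Continuous fun x => TypeSpace.value f (g x) := by
  refine ⟨fun h f => (continuous_value f).comp h, fun h => ?_⟩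
  exact continuous_iInf_rng.2 fun f => continuous_induced_rng.2 (h f)

theorem TypeSpace.ext_value {p q : TypeSpace M'}
    (h : ∀ f, TypeSpace.value f p = TypeSpace.value f q) : p = q :=
  Subtype.ext (funext h)

instance : T2Space (TypeSpace M') :=
  T2Space.of_injective_continuous (f := fun p f => TypeSpace.value f p)
    (fun _ _ h => TypeSpace.ext_value (congrFun h))
    (continuous_pi TypeSpace.continuous_value)

/-- The type space is the group of homomorphisms from `F` to the circle if the predicates are
multiplicative in `F` and all homomorphisms are realized. -/
noncomputable def TypeSpace.equivDual [CommGroup F] [TopologicalSpace F] [DiscreteTopology F]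
    (hmul : ∀ f g x, M'.pred (f * g) x = M'.pred f x * M'.pred g x)
    (hreal : ∀ χ : PontryaginDual F, ∃ x, ∀ f, M'.pred f x = χ f) :
    TypeSpace M' ≃ PontryaginDual F where
  toFun p := (⟨MonoidHom.mk' p.1 (by
    obtain ⟨_, x, rfl⟩ := p
    exact fun f g => hmul f g x), continuous_of_discreteTopology⟩ : F →ₜ* Circle)
  invFun χ := ⟨χ, (hreal χ).imp fun _ h => funext h⟩
  left_inv _ := rfl
  right_inv _ := rfl

/-- The identification of the type space with the dual of `F` is a homeomorphism. -/
noncomputable def TypeSpace.homeomorphDual [CommGroup F] [TopologicalSpace F] [DiscreteTopology F]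
    (hmul : ∀ f g x, M'.pred (f * g) x = M'.pred f x * M'.pred g x)
    (hreal : ∀ χ : PontryaginDual F, ∃ x, ∀ f, M'.pred f x = χ f) :
    TypeSpace M' ≃ₜ PontryaginDual F :=
  -- The inverse map is a continuous bijection from the compact dual to a Hausdorff space;
  -- compactness of the type space is then a consequence.
  (Continuous.homeoOfEquivCompactToT2 (f := (TypeSpace.equivDual hmul hreal).symm)
    (TypeSpace.continuous_iff.2 fun f => continuous_induced_rng.2
      (map_continuous (PontryaginDual.evalHom f)))).symm

theorem TypeSpace.homeomorphDual_apply [CommGroup F] [TopologicalSpace F] [DiscreteTopology F]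
    (hmul : ∀ f g x, M'.pred (f * g) x = M'.pred f x * M'.pred g x)
    (hreal : ∀ χ : PontryaginDual F, ∃ x, ∀ f, M'.pred f x = χ f) (p : TypeSpace M') (f : F) :
    TypeSpace.homeomorphDual hmul hreal p f = TypeSpace.value f p := rfl

end TypeSpace

end ContLogic

/-! ### Points of the group inside the dual of its characters. -/

/-- The evaluation homomorphism from a group to the dual of its group of characters. -/
noncomputable def CharGroup.evalPoint (A : Type u) [AddCommGroup A] [TopologicalSpace A] :
    Multiplicative A →* PontryaginDual (CharGroup A) where
  toFun a := (⟨MonoidHom.mk' (fun f : CharGroup A => f.app a.toAdd) fun _ _ => rfl,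
    continuous_of_discreteTopology⟩ : CharGroup A →ₜ* Circle)
  map_one' := PontryaginDual.ext fun f => map_one (ContinuousMonoidHom.toMonoidHom f)
  map_mul' a b := PontryaginDual.ext fun f => map_mul (ContinuousMonoidHom.toMonoidHom f) a b

theorem CharGroup.denseRange_evalPoint (A : Type u) [AddCommGroup A] [TopologicalSpace A] :
    DenseRange (CharGroup.evalPoint A) := by
  have h := PontryaginDual.dense_of_forall_apply_eq_one (CharGroup.evalPoint A).range
    (fun f hf => ContinuousMonoidHom.ext fun a => hf _ ⟨a, rfl⟩)
  rwa [MonoidHom.coe_range] at h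

theorem CharGroup.continuous_app {A : Type u} [AddCommGroup A] [TopologicalSpace A]
    (f : CharGroup A) : Continuous f.app :=
  (ContinuousMonoidHom.continuous_toFun f).comp continuous_ofAdd

theorem charStr_pred_add {A : Type u} [AddCommGroup A] [TopologicalSpace A] (f : CharGroup A)
    (x y : A) : (charStr A).pred f ((charStr A).add x y) =
      (charStr A).pred f x * (charStr A).pred f y :=
  map_mul (ContinuousMonoidHom.toMonoidHom f) (Multiplicative.ofAdd x) (Multiplicative.ofAdd y)

/-- By density, `χ` agrees up to `ε` on any finite set of characters with evaluation at some point
of `A`. The image of that point under `i` satisfies the same approximations, and saturation applies.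
-/
theorem charStr_exists_pred_eq {A : Type u} [AddCommGroup A] [TopologicalSpace A] {N : Type w}
    {M' : ContLogic.Str (CharGroup A) N} {i : A → N}
    (he : ContLogic.IsElementary (charStr A) M' i) (hs : ContLogic.IsSaturatedOver M' i)
    (χ : PontryaginDual (CharGroup A)) : ∃ x, ∀ f, M'.pred f x = χ f := by
  refine hs.exists_pred_eq χ fun s ε hε => ?_
  have hopen : IsOpen (⋂ f ∈ s, {ψ : PontryaginDual (CharGroup A) |
      ‖PontryaginDual.evalHom f ψ - χ f‖ < ε}) :=
    isOpen_biInter_finset fun f _ => isOpen_lt (by fun_prop) continuous_const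
  obtain ⟨a, ha⟩ := (CharGroup.denseRange_evalPoint A).exists_mem_open hopen
    ⟨χ, by simpa [PontryaginDual.evalHom_apply] using fun _ _ => hε⟩
  simp only [Set.mem_iInter] at ha
  refine ⟨i a.toAdd, fun f hf => ?_⟩
  rw [he.pred_apply]
  exact (ha f hf).le

end

theorem theorem3p1 (A : Type u) [AddCommGroup A] [TopologicalSpace A] [IsTopologicalAddGroup A] :
    -- the structure `M` has a saturated elementary extension
    (∃ (N : Type u) (M' : ContLogic.Str (CharGroup A) N) (i : A → N),
      ContLogic.IsElementary (charStr A) M' i ∧ ContLogic.IsSaturatedOver M' i) ∧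
    -- and for every saturated elementary extension, with the type space formed in it:
    ∀ (N : Type w) (M' : ContLogic.Str (CharGroup A) N) (i : A → N),
      ContLogic.IsElementary (charStr A) M' i → ContLogic.IsSaturatedOver M' i →
      ∃ _ : AddCommGroup (ContLogic.TypeSpace M'),
        -- the group operation is the well-defined operation `tp(a) +* tp(b) = tp(a +* b)`
        (∀ a b : N, ContLogic.tp M' a + ContLogic.tp M' b = ContLogic.tp M' (M'.add a b)) ∧
        -- (i)
        (IsTopologicalAddGroup (ContLogic.TypeSpace M') ∧ CompactSpace (ContLogic.TypeSpace M') ∧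
          T2Space (ContLogic.TypeSpace M')) ∧
        -- (ii)
        (∃ e : Multiplicative (ContLogic.TypeSpace M') ≃ₜ* PontryaginDual (CharGroup A),
          ∀ (p : ContLogic.TypeSpace M') (f : CharGroup A),
            e (Multiplicative.ofAdd p) f = ContLogic.TypeSpace.value f p) ∧
        -- (iii)
        (∃ j : A →ₜ+ ContLogic.TypeSpace M', (∀ a : A, j a = ContLogic.tp M' (i a)) ∧
          IsBohrCompactification.{u, u, v} j) := by
  refine ⟨ContLogic.exists_isSaturatedOver (charStr A), fun N M' i he hs => ?_⟩
  let e := ContLogic.TypeSpace.homeomorphDual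
    (he.pred_mul fun _ _ _ => rfl) (charStr_exists_pred_eq he hs)
  have hval : ∀ p f, e p f = ContLogic.TypeSpace.value f p := fun p f =>
    ContLogic.TypeSpace.homeomorphDual_apply _ _ p f
  let e' : ContLogic.TypeSpace M' ≃ Additive (PontryaginDual (CharGroup A)) :=
    e.toEquiv.trans Additive.ofMul
  -- Addition is transported from the dual; `htp` below identifies it with the operation induced by
  -- `M'.add`.
  let _ : AddCommGroup (ContLogic.TypeSpace M') := e'.addCommGroup
  have hadd : ∀ p q, e (p + q) = e p * e q := fun p q => e.apply_symm_apply _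
  have hvadd : ∀ p q f, ContLogic.TypeSpace.value f (p + q) =
      ContLogic.TypeSpace.value f p * ContLogic.TypeSpace.value f q := fun p q f => by
    rw [← hval, hadd]; rfl
  have hneg : ∀ p, e (-p) = (e p)⁻¹ := fun p => e.apply_symm_apply _
  have htop : IsTopologicalAddGroup (ContLogic.TypeSpace M') :=
    { continuous_add := e.isInducing.continuous_iff.2 (by
        rw [show e ∘ (fun p : ContLogic.TypeSpace M' × ContLogic.TypeSpace M' => p.1 + p.2) =
          fun p => e p.1 * e p.2 from funext fun p => hadd p.1 p.2]
        fun_prop)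
      continuous_neg := e.isInducing.continuous_iff.2 (by
        rw [show e ∘ (fun p : ContLogic.TypeSpace M' => -p) = fun p => (e p)⁻¹ from funext hneg]
        fun_prop) }
  have hcomp : CompactSpace (ContLogic.TypeSpace M') := e.symm.compactSpace
  -- Under `e`, the map `j` is evaluation at points of `A`; its additivity and dense range are read
  -- off from this.
  have hje : ∀ a, ContLogic.tp M' (i a) = e.symm (CharGroup.evalPoint A (Multiplicative.ofAdd a)) :=
    fun a => ContLogic.TypeSpace.ext_value fun f => he.pred_apply f a
  have htp : ∀ a b : N, ContLogic.tp M' a + ContLogic.tp M' b = ContLogic.tp M' (M'.add a b) :=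
    fun a b => ContLogic.TypeSpace.ext_value fun f =>
      (hvadd _ _ f).trans (he.pred_add charStr_pred_add f a b).symm
  let j : A →ₜ+ ContLogic.TypeSpace M' :=
    { AddMonoidHom.mk' (fun a => ContLogic.tp M' (i a)) (fun a b => e.injective (by
        rw [hadd, hje, hje, hje, e.apply_symm_apply, e.apply_symm_apply, e.apply_symm_apply,
          ofAdd_add, map_mul])) with
      continuous_toFun := ContLogic.TypeSpace.continuous_iff.2 fun f =>
        (CharGroup.continuous_app f).congr fun a => (he.pred_apply f a).symm }
  refine ⟨inferInstance, htp, ⟨htop, hcomp, inferInstance⟩,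
    ⟨{ e with
        map_mul' := hadd
        continuous_toFun := e.continuous
        continuous_invFun := e.symm.continuous }, hval⟩, j, fun a => rfl, ?_⟩
  refine isBohrCompactification_of_denseRange j ?_ fun f =>
    ⟨ContLogic.TypeSpace.value f, ContLogic.TypeSpace.continuous_value f, he.pred_apply f⟩
  have h : DenseRange (CharGroup.evalPoint A ∘ Multiplicative.ofAdd) := by
    rw [DenseRange, Multiplicative.ofAdd.surjective.range_comp]
    exact CharGroup.denseRange_evalPoint A
  rw [show (j : A → ContLogic.TypeSpace M') =
    e.symm ∘ CharGroup.evalPoint A ∘ Multiplicative.ofAdd from funext hje]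
  exact e.symm.surjective.denseRange.comp h e.symm.continuous
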